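/- Fix $0<q<1$, $n\in\mathbb N=\{0,1,2,\dots\}$ and $\alpha\in\mathbb R$; put $v=(\alpha,\beta)$ with $\beta=-n$, $|v|=\alpha+\beta=\alpha-n$, and assume $|v|>-1$. Let $\mathbb R_q^+=\{q^m:m\in\mathbb Z\}$, let $$\int_0^\infty f(x)\,d_qx=(1-q)\sum_{m\in\mathbb Z}f(q^m)q^m$$ (when the sum converges absolutely), and let $\mathcal L_{q,2,v}$ be the space of complex functions $f$ with $\|f\|_{q,2,v}=\big(\int_0^\infty|f(x)|^2x^{2|v|+1}d_qx\big)^{1/2}<\infty$. Put $(a,q)_k=\prod_{i=0}^{k-1}(1-aq^i)$, $(a,q)_\infty=\prod_{i\ge0}(1-aq^i)$, $$j_\nu(x,q^2)=\sum_{k\ge0}(-1)^k\frac{q^{k(k+1)}}{(q^{2\nu+2},q^2)_k(q^2,q^2)_k}x^{2k},\qquad \widetilde j_{q,v}(x,q^2)=x^{-2\beta}j_{\alpha-\beta}(q^{-\beta}x,q^2),$$ $$c_{q,v}=\frac{q^{n(\alpha+n+1)}}{1-q}\,\frac{(q^{2\alpha+2},q^2)_\infty}{(q^2,q^2)_\infty\,(q^{2\alpha+2},q^2)_n},$$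 $$\mathcal F_{q,v}f(x)=c_{q,v}\int_0^\infty f(t)\,\widetilde j_{q,v}(tx,q^2)\,t^{2|v|+1}d_qt,$$ $$T^v_{q,x}f(y)=c_{q,v}\int_0^\infty\mathcal F_{q,v}f(t)\,\widetilde j_{q,v}(yt,q^2)\,\widetilde j_{q,v}(xt,q^2)\,t^{2|v|+1}d_qt.$$ A generalized $q$-Bessel wavelet is an even function $\Psi\in\mathcal L_{q,2,v}$ with $C_{v,\Psi}=\int_0^\infty|\mathcal F_{q,v}\Psi(a)|^2\frac{d_qa}{a}<\infty$. For such $\Psi$ and for $a,b\in\mathbb R_q^+$ put $\Psi_a(x)=a^{-(2|v|+2)}\Psi(x/a)$, $\Psi_{(a,b),v}=\sqrt a\,T^v_{q,b}(\Psi_a)$ and $$C^v_{q,\Psi}(f)(a,b)=c_{q,v}\int_0^\infty f(x)\,\overline{\Psi_{(a,b),v}(x)}\,x^{2|v|+1}d_qx,\qquad f\in\mathcal L_{q,2,v}.$$ **Theorem.** Let $\Psi$ be a generalized $q$-Bessel wavelet that does not vanish identically on $\mathbb R_q^+$. Then $C_{v,\Psi}>0$, $\Psi_a\in\mathcal L_{q,2,v}$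 for all $a\in\mathbb R_q^+$, the $q$-integrals above and below all converge absolutely (for all parameters in $\mathbb R_q^+$ and all $f,g\in\mathcal L_{q,2,v}$; for the translation, with $\Psi_a$ in place of $f$), and: 1. (Plancherel) for all $f\in\mathcal L_{q,2,v}$, $$\frac1{C_{v,\Psi}}\int_0^\infty\!\!\int_0^\infty|C^v_{q,\Psi}(f)(a,b)|^2\,b^{2|v|+1}\frac{d_qa\,d_qb}{a^2}=\|f\|_{q,2,v}^2;$$ 2. (Parseval) for all $f,g\in\mathcal L_{q,2,v}$, $$\int_0^\infty f(x)\overline{g(x)}\,x^{2|v|+1}d_qx=\frac1{C_{v,\Psi}}\int_0^\infty\!\!\int_0^\infty C^v_{q,\Psi}(f)(a,b)\,\overline{C^v_{q,\Psi}(g)(a,b)}\,b^{2|v|+1}\frac{d_qa\,d_qb}{a^2}.$$ -/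

import Mathlib

namespace QBessel

noncomputable section

/-- `R_q^+ = {q ^ m : m ∈ ℤ}`. -/
def lattice (q : ℝ) : Set ℝ := Set.range fun m : ℤ => q ^ m

/-- Absolute convergence of the Jackson `q`-integral of `f` over `(0, ∞)`. -/
def QIntegrable {E : Type*} [NormedAddCommGroup E] [NormedSpace ℝ E] (q : ℝ) (f : ℝ → E) : Prop :=
  Summable fun m : ℤ => ‖q ^ m • f (q ^ m)‖

/-- The Jackson `q`-integral `∫_0^∞ f(x) d_q x = (1 - q) ∑_{m ∈ ℤ} f(q^m) q^m`. -/
def qIntegral {E : Type*} [NormedAddCommGroup E] [NormedSpace ℝ E] (q : ℝ) (f : ℝ → E) : E :=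
  (1 - q) • ∑' m : ℤ, q ^ m • f (q ^ m)

/-- Absolute convergence of the double Jackson `q`-integral of `F(a, b)` over `(0, ∞)²`. -/
def QIntegrable₂ {E : Type*} [NormedAddCommGroup E] [NormedSpace ℝ E] (q : ℝ)
    (F : ℝ → ℝ → E) : Prop :=
  Summable fun p : ℤ × ℤ => ‖(q ^ p.1 * q ^ p.2) • F (q ^ p.1) (q ^ p.2)‖

/-- The double `q`-integral `∫_0^∞ ∫_0^∞ F(a, b) d_q a d_q b`. -/
def qIntegral₂ {E : Type*} [NormedAddCommGroup E] [NormedSpace ℝ E] (q : ℝ)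
    (F : ℝ → ℝ → E) : E :=
  qIntegral q fun b => qIntegral q fun a => F a b

/-- `(a, q)_n = ∏_{k < n} (1 - a q^k)`. -/
def qPoch (a q : ℝ) (n : ℕ) : ℝ := ∏ k ∈ Finset.range n, (1 - a * q ^ k)

/-- `(a, q)_∞ = ∏_{k ≥ 0} (1 - a q^k)`. -/
def qPochInf (a q : ℝ) : ℝ := ∏' k : ℕ, (1 - a * q ^ k)

/-- The normalized `q`-Bessel function `j_ν(x, q²)`. -/
def qBessel (q ν x : ℝ) : ℝ :=
  ∑' k : ℕ, (-1) ^ k * (q ^ (k * (k + 1)) /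
    (qPoch (q ^ (2 * ν + 2)) (q ^ 2) k * qPoch (q ^ 2) (q ^ 2) k)) * x ^ (2 * k)

/-- The generalized `q`-Bessel function `x^{-2β} j_{α-β}(q^{-β} x, q²)`. -/
def genQBessel (q α β x : ℝ) : ℝ :=
  x ^ (-2 * β) * qBessel q (α - β) (q ^ (-β) * x)

/-- `|v| = α + β` for `v = (α, β)` with `β = -n`. -/
def absV (α : ℝ) (n : ℕ) : ℝ := α + -(n : ℝ)

/-- The normalization constant `c_{q,v}` for `v = (α, -n)`. -/
def cConst (q α : ℝ) (n : ℕ) : ℝ :=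
  q ^ ((n : ℝ) * (α + n + 1)) * qPochInf (q ^ (2 * α + 2)) (q ^ 2) /
    ((1 - q) * qPochInf (q ^ 2) (q ^ 2) * qPoch (q ^ (2 * α + 2)) (q ^ 2) n)

/-- The weight `x^{2|v|+1}` for `v = (α, -n)`. -/
def weight (α : ℝ) (n : ℕ) (x : ℝ) : ℝ := x ^ (2 * absV α n + 1)

/-- Membership in `L_{q,p,v}`, `v = (α, -n)`. Only the values of `f` on `R_q^+` matter. -/
def MemLq (q p α : ℝ) (n : ℕ) (f : ℝ → ℂ) : Prop :=
  QIntegrable q fun x => ‖f x‖ ^ p * weight α n x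

/-- The norm of `L_{q,p,v}`, `v = (α, -n)`. -/
def normLq (q p α : ℝ) (n : ℕ) (f : ℝ → ℂ) : ℝ :=
  (qIntegral q fun x => ‖f x‖ ^ p * weight α n x) ^ (1 / p)

/-- The integrand of the Fourier transform `F_{q,v} f` at `x`. -/
def fourierIntegrand (q α : ℝ) (n : ℕ) (f : ℝ → ℂ) (x t : ℝ) : ℂ :=
  f t * (genQBessel q α (-n) (t * x) : ℂ) * (weight α n t : ℂ)

/-- The generalized `q`-Bessel Fourier transform `F_{q,v}`, `v = (α, -n)`. -/
def fourier (q α : ℝ) (n : ℕ) (f : ℝ → ℂ) (x : ℝ) : ℂ :=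
  (cConst q α n : ℂ) * qIntegral q (fourierIntegrand q α n f x)

/-- The integrand of the translate `T_{q,x}^v f` at `y`. -/
def translationIntegrand (q α : ℝ) (n : ℕ) (x : ℝ) (f : ℝ → ℂ) (y t : ℝ) : ℂ :=
  fourier q α n f t * (genQBessel q α (-n) (y * t) : ℂ) * (genQBessel q α (-n) (x * t) : ℂ) *
    (weight α n t : ℂ)

/-- The generalized `q`-Bessel translation `T_{q,x}^v f (y)`, `v = (α, -n)`. -/
def translation (q α : ℝ) (n : ℕ) (x : ℝ) (f : ℝ → ℂ) (y : ℝ) : ℂ :=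
  (cConst q α n : ℂ) * qIntegral q (translationIntegrand q α n x f y)

/-- The dilate `Ψ_a(x) = a^{-(2|v|+2)} Ψ(x / a)`. -/
def dilate (α : ℝ) (n : ℕ) (Ψ : ℝ → ℂ) (a x : ℝ) : ℂ :=
  ((1 / a ^ (2 * absV α n + 2) : ℝ) : ℂ) * Ψ (x / a)

/-- `Ψ_{(a,b),v}(x) = √a T_{q,b}^v(Ψ_a)(x)`. -/
def waveletCopy (q α : ℝ) (n : ℕ) (Ψ : ℝ → ℂ) (a b x : ℝ) : ℂ :=
  (Real.sqrt a : ℂ) * translation q α n b (dilate α n Ψ a) x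

/-- The integrand of the wavelet transform of `f` at `(a, b)`. -/
def waveletIntegrand (q α : ℝ) (n : ℕ) (Ψ f : ℝ → ℂ) (a b x : ℝ) : ℂ :=
  f x * (starRingEnd ℂ) (waveletCopy q α n Ψ a b x) * (weight α n x : ℂ)

/-- The continuous generalized `q`-Bessel wavelet transform `C_{q,Ψ}^v(f)(a, b)`. -/
def waveletTransform (q α : ℝ) (n : ℕ) (Ψ f : ℝ → ℂ) (a b : ℝ) : ℂ :=
  (cConst q α n : ℂ) * qIntegral q (waveletIntegrand q α n Ψ f a b)

/-- The admissibility constant `C_{v,Ψ} = ∫_0^∞ |F_{q,v} Ψ(a)|² d_q a / a`. -/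
def admConst (q α : ℝ) (n : ℕ) (Ψ : ℝ → ℂ) : ℝ :=
  qIntegral q fun a => ‖fourier q α n Ψ a‖ ^ 2 / a

/-- Generalized `q`-Bessel wavelets: even functions in `L_{q,2,v}` with `C_{v,Ψ} < ∞`. -/
structure IsWavelet (q α : ℝ) (n : ℕ) (Ψ : ℝ → ℂ) : Prop where
  even : Function.Even Ψ
  memLq : MemLq q 2 α n Ψ
  admissible : QIntegrable q fun a => ‖fourier q α n Ψ a‖ ^ 2 / a

end

end QBessel

/-!
A function in `L_{q,2,v}` is a sequence in `ℓ²(ℤ)`: its values on `q^ℤ`, weighted by the square root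
of the measure. In this model `F_{q,v}` is the matrix `(h (m + k))`, where `h` samples the
`q`-Bessel function. With `p = q²` and `σ = q^{α+n+1}`, the sequence `h` is, up to a shift,
the cross-correlation of the Taylor coefficients of `E(σw) = (σw, p)_∞` and `e(σw) = 1 / (σw, p)_∞`,
that is, the sequence of Fourier coefficients of `conj (E(σw)) e(σw)` on `|w| = 1`. This function is
unimodular, so `F_{q,v}` is an orthogonal symmetric matrix, hence an isometric involution. The
wavelet transform of `f` at the scale `a` is then, up to normalization, the Fourier transform of
`F f · conj (F Ψ (a ·))`; applying the isometry at each scale and summing over `a`, the dilation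
invariance of `d_q a / a` produces the factor `C_{v,Ψ}`.
-/

namespace QBessel

open Filter Topology ComplexConjugate

/-! ### The two `q`-exponentials -/

/-- The Taylor coefficients of the entire `q`-exponential `E_p(-x) = (x, p)_∞`. -/
noncomputable def bigQExpCoeff (p : ℝ) (l : ℕ) : ℝ := (-1) ^ l * p ^ l.choose 2 / qPoch p p l

/-- The Taylor coefficients of the `q`-exponential `e_p(x) = 1 / (x, p)_∞`, `|x| < 1`. -/
noncomputable def smallQExpCoeff (p : ℝ) (l : ℕ) : ℝ := 1 / qPoch p p l

lemma qPoch_succ (a p : ℝ) (l : ℕ) : qPoch a p (l + 1) = qPoch a p l * (1 - a * p ^ l) := by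
  simp only [qPoch, Finset.prod_range_succ]

lemma bigQExpCoeff_zero (p : ℝ) : bigQExpCoeff p 0 = 1 := by simp [bigQExpCoeff, qPoch]

lemma smallQExpCoeff_zero (p : ℝ) : smallQExpCoeff p 0 = 1 := by simp [smallQExpCoeff, qPoch]

section PowerSeries
variable {𝕜 : Type*} [NormedField 𝕜] [NormedAlgebra ℝ 𝕜]

lemma summable_norm_smul_pow_of_tendsto_ratio {c r : ℕ → ℝ} {ρ : ℝ}
    (hc : ∀ l, c (l + 1) = r l * c l) (hr : Tendsto r atTop (𝓝 ρ)) {x : 𝕜}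
    (hx : |ρ| * ‖x‖ < 1) : Summable fun l => ‖c l • x ^ l‖ := by
  obtain ⟨s, hρs, hs1⟩ := exists_between hx
  have hrs : ∀ᶠ l in atTop, |r l| * ‖x‖ ≤ s := (hr.abs.mul_const ‖x‖).eventually_le_const hρs
  refine summable_of_ratio_norm_eventually_le hs1 ?_
  filter_upwards [hrs] with l hl
  rw [norm_norm, norm_norm]
  calc ‖c (l + 1) • x ^ (l + 1)‖ = |r l| * ‖x‖ * ‖c l • x ^ l‖ := by
        rw [hc, pow_succ]
        simp only [norm_smul, norm_mul, Real.norm_eq_abs]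
        ring
    _ ≤ s * ‖c l • x ^ l‖ := by gcongr

lemma tsum_smul_pow_sub_tsum_smul_smul_pow [CompleteSpace 𝕜] {c : ℕ → ℝ} {p : ℝ} {x : 𝕜}
    (hx : Summable fun l => c l • x ^ l) (hpx : Summable fun l => c l • (p • x) ^ l) :
    ∑' l, c l • x ^ l - ∑' l, c l • (p • x) ^ l =
      x * ∑' l, (c (l + 1) * (1 - p ^ (l + 1))) • x ^ l := by
  rw [← hx.tsum_sub hpx, (hx.sub hpx).tsum_eq_zero_add, ← tsum_mul_left]
  simp only [pow_zero, sub_self, zero_add]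
  refine tsum_congr fun l => ?_
  rw [smul_pow, smul_smul, ← sub_smul, mul_smul_comm, ← pow_succ']
  ring_nf

lemma tendsto_tsum_smul_pow_smul [CompleteSpace 𝕜] {c : ℕ → ℝ} {p : ℝ} (hp0 : 0 < p) (hp1 : p < 1)
    {x : 𝕜} (hx : Summable fun l => ‖c l • x ^ l‖) :
    Tendsto (fun k : ℕ => ∑' l, c l • (p ^ k • x) ^ l) atTop (𝓝 (c 0 • 1)) := by
  have hzero : ∑' l, c l • (0 : 𝕜) ^ l = c 0 • 1 := by
    rw [tsum_eq_single 0 fun l hl => by rw [zero_pow hl, smul_zero], pow_zero]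
  have hshrink : Tendsto (fun k : ℕ => p ^ k • x) atTop (𝓝 0) := by
    simpa only [zero_smul] using (tendsto_pow_atTop_nhds_zero_of_lt_one hp0.le hp1).smul_const x
  rw [← hzero]
  refine tendsto_tsum_of_dominated_convergence hx
    (fun l => (hshrink.pow l).const_smul (c l)) (.of_forall fun k l => ?_)
  rw [norm_smul, norm_smul, norm_pow, norm_pow, norm_smul, Real.norm_of_nonneg (pow_pos hp0 k).le]
  gcongr
  exact mul_le_of_le_one_left (norm_nonneg x) (pow_le_one₀ hp0.le hp1.le)

end PowerSeries

section
variable {p : ℝ} (hp0 : 0 < p) (hp1 : p < 1)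
include hp0 hp1

lemma qPoch_pos {a : ℝ} (ha : a < 1) (l : ℕ) : 0 < qPoch a p l := by
  refine Finset.prod_pos fun k _ => sub_pos.2 ?_
  calc a * p ^ k ≤ max a 0 * 1 := by
        gcongr
        exacts [le_max_left a 0, pow_le_one₀ hp0.le hp1.le]
    _ < 1 := by simpa using ha

lemma one_sub_pow_succ_pos (l : ℕ) : 0 < 1 - p ^ (l + 1) :=
  sub_pos.2 (pow_lt_one₀ hp0.le hp1 l.succ_ne_zero)

lemma tendsto_one_sub_pow_succ : Tendsto (fun l : ℕ => 1 - p ^ (l + 1)) atTop (𝓝 1) := by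
  simpa using ((tendsto_pow_atTop_nhds_zero_of_lt_one hp0.le hp1).comp
    (tendsto_add_atTop_nat 1)).const_sub 1

lemma bigQExpCoeff_succ (l : ℕ) :
    bigQExpCoeff p (l + 1) * (1 - p ^ (l + 1)) = -(p ^ l * bigQExpCoeff p l) := by
  have hl := (qPoch_pos hp0 hp1 hp1 l).ne'
  have hne := (one_sub_pow_succ_pos hp0 hp1 l).ne'
  rw [bigQExpCoeff, bigQExpCoeff, qPoch_succ, ← pow_succ', Nat.choose_succ_succ' l 1,
    Nat.choose_one_right]
  field_simp
  ring

lemma smallQExpCoeff_succ (l : ℕ) :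
    smallQExpCoeff p (l + 1) * (1 - p ^ (l + 1)) = smallQExpCoeff p l := by
  have hl := (qPoch_pos hp0 hp1 hp1 l).ne'
  have hne := (one_sub_pow_succ_pos hp0 hp1 l).ne'
  rw [smallQExpCoeff, smallQExpCoeff, qPoch_succ, ← pow_succ']
  field_simp

end

section
variable {𝕜 : Type*} [NormedField 𝕜] [NormedAlgebra ℝ 𝕜]

/-- The entire `q`-exponential `E_p(-x) = ∑ (-1)^l p^{l(l-1)/2} x^l / (p, p)_l`. -/
noncomputable def bigQExp (p : ℝ) (x : 𝕜) : 𝕜 := ∑' l : ℕ, bigQExpCoeff p l • x ^ l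

/-- The `q`-exponential `e_p(x) = ∑ x^l / (p, p)_l` on the unit disc. -/
noncomputable def smallQExp (p : ℝ) (x : 𝕜) : 𝕜 := ∑' l : ℕ, smallQExpCoeff p l • x ^ l

variable {p : ℝ} (hp0 : 0 < p) (hp1 : p < 1)
include hp0 hp1

lemma summable_norm_bigQExp (x : 𝕜) : Summable fun l => ‖bigQExpCoeff p l • x ^ l‖ := by
  have hratio : Tendsto (fun l : ℕ => -p ^ l / (1 - p ^ (l + 1))) atTop (𝓝 0) := by
    simpa [Pi.div_def] using (tendsto_pow_atTop_nhds_zero_of_lt_one hp0.le hp1).neg.div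
      (tendsto_one_sub_pow_succ hp0 hp1) one_ne_zero
  refine summable_norm_smul_pow_of_tendsto_ratio (fun l => ?_) hratio (by simp)
  rw [eq_div_of_mul_eq (one_sub_pow_succ_pos hp0 hp1 l).ne' (bigQExpCoeff_succ hp0 hp1 l)]
  ring

lemma summable_norm_smallQExp {x : 𝕜} (hx : ‖x‖ < 1) :
    Summable fun l => ‖smallQExpCoeff p l • x ^ l‖ := by
  have hratio : Tendsto (fun l : ℕ => (1 - p ^ (l + 1))⁻¹) atTop (𝓝 1) := by
    simpa using (tendsto_one_sub_pow_succ hp0 hp1).inv₀ one_ne_zero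
  refine summable_norm_smul_pow_of_tendsto_ratio (fun l => ?_) hratio (by simpa using hx)
  rw [eq_div_of_mul_eq (one_sub_pow_succ_pos hp0 hp1 l).ne' (smallQExpCoeff_succ hp0 hp1 l),
    div_eq_inv_mul]

variable [CompleteSpace 𝕜]

lemma tendsto_bigQExp_pow_smul (x : 𝕜) :
    Tendsto (fun k : ℕ => bigQExp p (p ^ k • x)) atTop (𝓝 1) := by
  have hlim := tendsto_tsum_smul_pow_smul hp0 hp1 (summable_norm_bigQExp hp0 hp1 x)
  rwa [bigQExpCoeff_zero, one_smul] at hlim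

lemma tendsto_smallQExp_pow_smul {x : 𝕜} (hx : ‖x‖ < 1) :
    Tendsto (fun k : ℕ => smallQExp p (p ^ k • x)) atTop (𝓝 1) := by
  have hlim := tendsto_tsum_smul_pow_smul hp0 hp1 (summable_norm_smallQExp hp0 hp1 hx)
  rwa [smallQExpCoeff_zero, one_smul] at hlim

lemma bigQExp_eq_one_sub_mul (x : 𝕜) : bigQExp p x = (1 - x) * bigQExp p (p • x) := by
  have hdiff : bigQExp p x - bigQExp p (p • x) = x * -bigQExp p (p • x) := by
    rw [bigQExp, bigQExp, tsum_smul_pow_sub_tsum_smul_smul_pow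
      (summable_norm_bigQExp hp0 hp1 x).of_norm (summable_norm_bigQExp hp0 hp1 (p • x)).of_norm,
      ← tsum_neg]
    simp only [bigQExpCoeff_succ hp0 hp1, smul_pow, smul_smul, neg_smul, mul_comm]
  linear_combination hdiff

lemma smallQExp_smul_eq_one_sub_mul {x : 𝕜} (hx : ‖x‖ < 1) :
    smallQExp p (p • x) = (1 - x) * smallQExp p x := by
  have hpx : ‖p • x‖ < 1 := by
    rw [norm_smul, Real.norm_of_nonneg hp0.le]
    exact mul_lt_one_of_nonneg_of_lt_one_left hp0.le hp1 hx.le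
  have hdiff : smallQExp p x - smallQExp p (p • x) = x * smallQExp p x := by
    rw [smallQExp, smallQExp, tsum_smul_pow_sub_tsum_smul_smul_pow
      (summable_norm_smallQExp hp0 hp1 hx).of_norm (summable_norm_smallQExp hp0 hp1 hpx).of_norm]
    simp only [smallQExpCoeff_succ hp0 hp1]
  linear_combination -hdiff

lemma bigQExp_mul_smallQExp {x : 𝕜} (hx : ‖x‖ < 1) : bigQExp p x * smallQExp p x = 1 := by
  have hinv (k : ℕ) : bigQExp p (p ^ k • x) * smallQExp p (p ^ k • x) =
      bigQExp p x * smallQExp p x := by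
    induction k with
    | zero => simp only [pow_zero, one_smul]
    | succ k ih =>
      have hk : ‖p ^ k • x‖ < 1 := by
        rw [norm_smul, Real.norm_of_nonneg (by positivity)]
        exact mul_lt_one_of_nonneg_of_lt_one_right (pow_le_one₀ hp0.le hp1.le) (norm_nonneg x) hx
      rw [← ih, pow_succ', mul_smul, smallQExp_smul_eq_one_sub_mul hp0 hp1 hk,
        bigQExp_eq_one_sub_mul hp0 hp1 (p ^ k • x)]
      ring
  have hlim := (tendsto_bigQExp_pow_smul hp0 hp1 x).mul (tendsto_smallQExp_pow_smul hp0 hp1 hx)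
  simp only [hinv, mul_one] at hlim
  exact tendsto_nhds_unique tendsto_const_nhds hlim

end

section
variable {p : ℝ} (hp0 : 0 < p) (hp1 : p < 1)
include hp0 hp1

lemma bigQExp_eq_qPoch_mul (x : ℝ) (k : ℕ) :
    bigQExp p x = qPoch x p k * bigQExp p (p ^ k * x) := by
  induction k with
  | zero => simp [qPoch]
  | succ k ih =>
    rw [ih, qPoch_succ, bigQExp_eq_one_sub_mul hp0 hp1 (p ^ k * x), smul_eq_mul, pow_succ',
      mul_assoc, mul_assoc, mul_comm x]

lemma qPochInf_eq_bigQExp (x : ℝ) : qPochInf x p = bigQExp p x := by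
  have hmul : Multipliable fun k : ℕ => 1 - x * p ^ k := by
    simpa only [sub_eq_add_neg] using multipliable_one_add_of_summable
      ((summable_geometric_of_lt_one hp0.le hp1).mul_left x).neg.norm
  have hlim : Tendsto (fun k => qPoch x p k * bigQExp p (p ^ k • x)) atTop (𝓝 (qPochInf x p * 1)) :=
    hmul.hasProd.tendsto_prod_nat.mul (tendsto_bigQExp_pow_smul hp0 hp1 x)
  simp only [smul_eq_mul, ← bigQExp_eq_qPoch_mul hp0 hp1, mul_one] at hlim
  exact tendsto_nhds_unique hlim tendsto_const_nhds

lemma qPochInf_eq_qPoch_mul (x : ℝ) (k : ℕ) :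
    qPochInf x p = qPoch x p k * qPochInf (p ^ k * x) p := by
  simp only [qPochInf_eq_bigQExp hp0 hp1, ← bigQExp_eq_qPoch_mul hp0 hp1]

lemma qPochInf_self_ne_zero : qPochInf p p ≠ 0 := by
  rw [qPochInf_eq_bigQExp hp0 hp1]
  exact left_ne_zero_of_mul_eq_one
    (bigQExp_mul_smallQExp hp0 hp1 (by rwa [Real.norm_of_nonneg hp0.le]))

lemma qPochInf_zpow_succ (m : ℤ) :
    qPochInf (p ^ (m + 1)) p =
      qPochInf p p * Function.extend ((↑) : ℕ → ℤ) (smallQExpCoeff p) 0 m := by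
  by_cases hm : ∃ k : ℕ, (k : ℤ) = m
  · obtain ⟨k, rfl⟩ := hm
    have hk := (qPoch_pos hp0 hp1 hp1 k).ne'
    rw [Nat.cast_injective.extend_apply, smallQExpCoeff, qPochInf_eq_qPoch_mul hp0 hp1 p k,
      zpow_add_one₀ hp0.ne', zpow_natCast]
    field_simp
  · obtain ⟨k, hk⟩ : ∃ k : ℕ, m + 1 = -k :=
      ⟨(-(m + 1)).toNat, by have := mt (fun h => ⟨m.toNat, Int.toNat_of_nonneg h⟩) hm; omega⟩
    rw [Function.extend_apply' _ _ _ hm, Pi.zero_apply, mul_zero, hk,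
      qPochInf_eq_qPoch_mul hp0 hp1 _ (k + 1), qPoch_succ, zpow_neg, zpow_natCast,
      inv_mul_cancel₀ (by positivity), sub_self, mul_zero, zero_mul]

end

/-! ### Orthogonal Hankel matrices -/

/-- The bilateral Hankel matrix `(h (m + k))` indexed by `m, k ∈ ℤ` is orthogonal. -/
def IsOrthogonalHankel (h : ℤ → ℝ) : Prop :=
  ∀ k l : ℤ, HasSum (fun m => h (m + k) * h (m + l)) (if k = l then 1 else 0)

lemma IsOrthogonalHankel.comp_add_left {h : ℤ → ℝ} (hh : IsOrthogonalHankel h) (r : ℤ) :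
    IsOrthogonalHankel fun s => h (r + s) := fun k l => by
  simpa only [Function.comp_def, Equiv.coe_addLeft, add_assoc] using
    (Equiv.addLeft r).hasSum_iff.2 (hh k l)

section Circle
open AddCircle
variable {T : ℝ} [Fact (0 < T)]

lemma inner_fourierLp_toLp (f : C(AddCircle T, ℂ)) (d : ℤ) :
    inner ℂ (fourierLp 2 d) (ContinuousMap.toLp 2 haarAddCircle ℂ f) = fourierCoeff f d := by
  rw [← fourierCoeff_toLp, ← fourierBasis_repr, HilbertBasis.repr_apply_apply, coe_fourierBasis]

lemma hasSum_fourierCoeff {ι : Type*} {F : ι → C(AddCircle T, ℂ)} {f : C(AddCircle T, ℂ)}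
    (hF : HasSum F f) (d : ℤ) : HasSum (fun i => fourierCoeff (F i) d) (fourierCoeff f d) := by
  simpa only [ContinuousLinearMap.comp_apply, innerSL_apply_apply, inner_fourierLp_toLp] using
    hF.mapL ((innerSL ℂ (fourierLp 2 d)).comp (ContinuousMap.toLp 2 haarAddCircle ℂ))

lemma fourierCoeff_fourier_neg_mul (f : C(AddCircle T, ℂ)) (k m : ℤ) :
    fourierCoeff (_root_.fourier (-k) * f : C(AddCircle T, ℂ)) m = fourierCoeff f (m + k) := by
  refine MeasureTheory.integral_congr_ae (.of_forall fun θ => ?_)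
  simp only [ContinuousMap.mul_apply, smul_eq_mul, ← mul_assoc, ← fourier_add, neg_add]

/-- Multiplication by a unimodular function is unitary, so it preserves the orthonormality of the
characters. -/
theorem isOrthogonalHankel_of_fourierCoeff {φ : C(AddCircle T, ℂ)} (hφ : ∀ θ, ‖φ θ‖ = 1)
    {h : ℤ → ℝ} (hh : ∀ d, fourierCoeff φ d = h d) : IsOrthogonalHankel h := by
  intro k l
  let shifted (k : ℤ) := ContinuousMap.toLp (E := ℂ) 2 haarAddCircle ℂ (_root_.fourier (-k) * φ)
  have hcoeff (k m : ℤ) : inner ℂ (fourierBasis m) (shifted k) = (h (m + k) : ℂ) := by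
    rw [coe_fourierBasis, inner_fourierLp_toLp, fourierCoeff_fourier_neg_mul, hh]
  have hinner : inner ℂ (shifted k) (shifted l) = ((if k = l then 1 else 0 : ℝ) : ℂ) := by
    have horth := orthonormal_iff_ite.1 (orthonormal_fourier (T := T)) (-k) (-l)
    simp only [fourierLp, MeasureTheory.ContinuousMap.inner_toLp, neg_inj] at horth
    rw [MeasureTheory.ContinuousMap.inner_toLp, apply_ite Complex.ofReal, Complex.ofReal_one,
      Complex.ofReal_zero, ← horth]
    refine MeasureTheory.integral_congr_ae (.of_forall fun θ => ?_)
    have hunit : φ θ * conj (φ θ) = 1 := by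
      rw [Complex.mul_conj, Complex.normSq_eq_norm_sq, hφ, one_pow, Complex.ofReal_one]
    simp only [ContinuousMap.mul_apply, map_mul]
    linear_combination (_root_.fourier (-l) θ * conj (_root_.fourier (-k) θ)) * hunit
  have hsum := fourierBasis.hasSum_inner_mul_inner (shifted k) (shifted l)
  simp only [hcoeff, hinner, ← inner_conj_symm (shifted k), Complex.conj_ofReal,
    ← Complex.ofReal_mul] at hsum
  exact Complex.hasSum_ofReal.1 hsum

end Circle

/-- The cross-correlation `d ↦ ∑ a_l b_{d+l}` of two one-sided sequences; `Function.extend` extends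
`b` by zero to negative indices. -/
noncomputable def crossCorrelation (a b : ℕ → ℝ) (d : ℤ) : ℝ :=
  ∑' l : ℕ, a l * Function.extend ((↑) : ℕ → ℤ) b 0 (d + l)

lemma hasSum_ite_sub_eq (b : ℕ → ℝ) (l d : ℤ) :
    HasSum (fun m : ℕ => if (m : ℤ) - l = d then b m else 0)
      (Function.extend ((↑) : ℕ → ℤ) b 0 (d + l)) := by
  simp only [sub_eq_iff_eq_add]
  by_cases hd : ∃ m : ℕ, (m : ℤ) = d + l
  · obtain ⟨m, hm⟩ := hd
    rw [← hm, Nat.cast_injective.extend_apply]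
    simp only [Nat.cast_inj]
    simpa only [if_true] using
      hasSum_single (f := fun i => if i = m then b i else 0) m fun i hi => if_neg hi
  · rw [Function.extend_apply' _ _ _ hd, Pi.zero_apply]
    simpa only [if_neg (not_exists.1 hd _)] using hasSum_zero

/-- The matrix entries are the Fourier coefficients of `conj A * B`, where `A` and `B` are the
boundary values of the two power series. -/
theorem isOrthogonalHankel_crossCorrelation {a b : ℕ → ℝ} (ha : Summable fun l => ‖a l‖)
    (hb : Summable fun l => ‖b l‖)
    (hab : ∀ z : ℂ, ‖z‖ = 1 → ‖(∑' l, a l • z ^ l) * ∑' l, b l • z ^ l‖ = 1) :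
    IsOrthogonalHankel (crossCorrelation a b) := by
  let F (x : ℕ × ℕ) : C(AddCircle (1 : ℝ), ℂ) := (a x.1 * b x.2) • _root_.fourier (x.2 - x.1)
  have hF : Summable F := .of_norm <| by
    simpa only [F, norm_smul, fourier_norm, mul_one] using ha.mul_norm hb
  refine isOrthogonalHankel_of_fourierCoeff (φ := ∑' x, F x) (fun θ => ?_) fun d => ?_
  · set z : ℂ := _root_.fourier 1 θ with hz
    have hz1 : ‖z‖ = 1 := by rw [hz, fourier_one, Circle.norm_coe]
    have hpow (l : ℕ) : (_root_.fourier l θ : ℂ) = z ^ l := by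
      rw [hz, fourier_one, fourier_apply, natCast_zsmul, AddCircle.toCircle_nsmul, Circle.coe_pow]
    have hA : Summable fun l => ‖a l • conj z ^ l‖ := by simpa [norm_smul, hz1] using ha
    have hB : Summable fun l => ‖b l • z ^ l‖ := by simpa [norm_smul, hz1] using hb
    have hφ : (∑' x, F x) θ = conj (∑' l, a l • z ^ l) * ∑' l, b l • z ^ l := by
      rw [← ContinuousMap.tsum_apply hF, Complex.conj_tsum]
      simp only [Complex.real_smul, map_mul, map_pow, Complex.conj_ofReal]
      simp only [← Complex.real_smul]
      rw [tsum_mul_tsum_of_summable_norm hA hB]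
      refine tsum_congr fun x => ?_
      simp only [F, ContinuousMap.smul_apply, sub_eq_add_neg, fourier_add, fourier_neg, hpow,
        map_pow, smul_mul_smul_comm, mul_comm]
    rw [hφ, norm_mul, Complex.norm_conj, ← norm_mul, hab z hz1]
  · have hcoeff (x : ℕ × ℕ) : fourierCoeff (F x) d =
        ((a x.1 * if (x.2 : ℤ) - x.1 = d then b x.2 else 0 : ℝ) : ℂ) := by
      have hcoe : ⇑(F x) = ((a x.1 * b x.2 : ℝ) : ℂ) • ⇑(_root_.fourier (x.2 - x.1)) := by
        ext θ
        simp only [F, ContinuousMap.smul_apply, Pi.smul_apply, Complex.real_smul, smul_eq_mul]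
      rw [hcoe, fourierCoeff.const_smul, fourierCoeff_fourier, Pi.single_apply, smul_eq_mul]
      simp only [eq_comm (a := d)]
      split_ifs <;> simp
    have hsum := hasSum_fourierCoeff hF.hasSum d
    simp only [hcoeff] at hsum
    have hsum' := hsum.prod_fiberwise fun l =>
      Complex.hasSum_ofReal.2 ((hasSum_ite_sub_eq b l d).mul_left (a l))
    rw [crossCorrelation, Complex.ofReal_tsum, hsum'.tsum_eq]

/-! ### The `q`-Bessel functions on the lattice -/

/-- The values `σ^r (σ², p)_∞ / (p, p)_∞ · j_ν(q^r, q²)` of a `q`-Bessel function on the lattice,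
where `p = q²` and `σ = q^{ν+1}`, as a correlation of Taylor coefficients of the two
`q`-exponentials. -/
noncomputable def besselSeq (p σ : ℝ) : ℤ → ℝ :=
  crossCorrelation (fun l => bigQExpCoeff p l * σ ^ l) fun l => smallQExpCoeff p l * σ ^ l

section
variable {p σ : ℝ} (hp0 : 0 < p) (hp1 : p < 1)
include hp0 hp1

/-- On `|w| = 1` the two power series are `E(σw)` and `e(σw)`, whose product is `1`. -/
theorem isOrthogonalHankel_besselSeq (hσ : |σ| < 1) : IsOrthogonalHankel (besselSeq p σ) := by
  refine isOrthogonalHankel_crossCorrelation (summable_norm_bigQExp hp0 hp1 σ)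
    (summable_norm_smallQExp hp0 hp1 hσ) fun z hz => ?_
  have hσz : ‖σ • z‖ < 1 := by rwa [norm_smul, hz, mul_one]
  simp only [mul_smul, ← smul_pow]
  rw [← bigQExp, ← smallQExp, bigQExp_mul_smallQExp hp0 hp1 hσz, norm_one]

lemma tsum_bigQExpCoeff_mul_qPochInf_comm (s z : ℝ) :
    ∑' k : ℕ, bigQExpCoeff p k * z ^ k * qPochInf (p ^ k * s) p =
      ∑' l : ℕ, bigQExpCoeff p l * s ^ l * qPochInf (p ^ l * z) p := by
  let term (k l : ℕ) : ℝ := bigQExpCoeff p k * z ^ k * (bigQExpCoeff p l * (p ^ k * s) ^ l)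
  have hterm : Summable (Function.uncurry term) := by
    refine .of_norm_bounded
      ((summable_norm_bigQExp hp0 hp1 z).mul_norm (summable_norm_bigQExp hp0 hp1 s)) fun x => ?_
    have hle : (|p| ^ x.1) ^ x.2 ≤ 1 := by
      rw [abs_of_pos hp0]
      exact pow_le_one₀ (by positivity) (pow_le_one₀ hp0.le hp1.le)
    simp only [term, Function.uncurry, smul_eq_mul, norm_mul, norm_pow, Real.norm_eq_abs, mul_pow]
    gcongr
    exact mul_le_of_le_one_left (by positivity) hle
  have hrow (k : ℕ) : bigQExpCoeff p k * z ^ k * qPochInf (p ^ k * s) p = ∑' l, term k l := by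
    rw [qPochInf_eq_bigQExp hp0 hp1, bigQExp, ← tsum_mul_left]
    rfl
  have hcol (l : ℕ) : bigQExpCoeff p l * s ^ l * qPochInf (p ^ l * z) p = ∑' k, term k l := by
    rw [qPochInf_eq_bigQExp hp0 hp1, bigQExp, ← tsum_mul_left]
    refine tsum_congr fun k => ?_
    simp only [term, smul_eq_mul, mul_pow, ← pow_mul, mul_comm k l]
    ring
  rw [tsum_congr hrow, tsum_congr hcol, hterm.tsum_comm]

/-- The symmetry above turns the defining sum into `∑ (-1)^l p^{l(l-1)/2} σ^{2l} (p^{l+r+1}, p)_∞`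
up to the factors `(p, p)_l`, whose terms with `l + r < 0` vanish. -/
lemma besselSeq_mul_qPochInf (hσ : σ ≠ 0) (r : ℤ) :
    besselSeq p σ r * qPochInf p p =
      σ ^ r * ∑' k : ℕ, bigQExpCoeff p k * (p ^ (r + 1)) ^ k * qPochInf (p ^ k * σ ^ 2) p := by
  rw [tsum_bigQExpCoeff_mul_qPochInf_comm hp0 hp1, besselSeq, crossCorrelation, ← tsum_mul_right,
    ← tsum_mul_left]
  refine tsum_congr fun l => ?_
  have hshift : p ^ l * p ^ (r + 1) = p ^ (r + l + 1) := by
    rw [← zpow_natCast p l, ← zpow_add₀ hp0.ne']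
    ring_nf
  rw [hshift, qPochInf_zpow_succ hp0 hp1]
  by_cases hl : ∃ m : ℕ, (m : ℤ) = r + l
  · obtain ⟨m, hm⟩ := hl
    have hσm : σ ^ m = σ ^ r * σ ^ l := by
      rw [← zpow_natCast, hm, zpow_add₀ hσ, zpow_natCast]
    rw [← hm, Nat.cast_injective.extend_apply, Nat.cast_injective.extend_apply, hσm]
    ring
  · simp only [Function.extend_apply' _ _ _ hl, Pi.zero_apply, mul_zero, zero_mul]

end

lemma pow_mul_succ_eq (q : ℝ) (k : ℕ) :
    q ^ (k * (k + 1)) = (q ^ 2) ^ k.choose 2 * (q ^ 2) ^ k := by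
  have hchoose : (k + 1).choose 2 = k.choose 2 + k := by
    rw [Nat.choose_succ_succ' k 1, Nat.choose_one_right, add_comm]
  rw [← pow_add, ← hchoose, Nat.choose_two_right, ← pow_mul, Nat.add_sub_cancel,
    mul_comm (k + 1), Nat.mul_div_cancel' (Nat.even_mul_succ_self k).two_dvd]

lemma rpow_zpow_comm {q : ℝ} (hq : 0 < q) (x : ℝ) (m : ℤ) : (q ^ m) ^ x = (q ^ x) ^ m := by
  rw [← Real.rpow_intCast, ← Real.rpow_intCast, ← Real.rpow_mul hq.le,
    ← Real.rpow_mul hq.le, mul_comm]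

section
variable {q : ℝ} (hq0 : 0 < q) (hq1 : q < 1)
include hq0 hq1

lemma qPoch_rpow_pos {ν : ℝ} (hν : -1 < ν) (k : ℕ) : 0 < qPoch (q ^ (2 * ν + 2)) (q ^ 2) k :=
  qPoch_pos (by positivity) (pow_lt_one₀ hq0.le hq1 two_ne_zero)
    (Real.rpow_lt_one hq0.le hq1 (by linarith)) k

lemma qPochInf_mul_qBessel {ν : ℝ} (hν : -1 < ν) (x : ℝ) :
    qPochInf (q ^ (2 * ν + 2)) (q ^ 2) * qBessel q ν x =
      ∑' k : ℕ, bigQExpCoeff (q ^ 2) k * (q ^ 2 * x ^ 2) ^ k *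
        qPochInf ((q ^ 2) ^ k * q ^ (2 * ν + 2)) (q ^ 2) := by
  have hp0 : 0 < q ^ 2 := by positivity
  have hp1 : q ^ 2 < 1 := pow_lt_one₀ hq0.le hq1 two_ne_zero
  rw [qBessel, ← tsum_mul_left]
  refine tsum_congr fun k => ?_
  have hs := (qPoch_rpow_pos hq0 hq1 hν k).ne'
  have hp := (qPoch_pos hp0 hp1 hp1 k).ne'
  rw [qPochInf_eq_qPoch_mul hp0 hp1 _ k, bigQExpCoeff, pow_mul_succ_eq, mul_pow (q ^ 2),
    ← pow_mul x]
  generalize q ^ (2 * ν + 2) = s at *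
  field_simp

lemma besselSeq_mul_qPochInf_eq_qBessel {ν : ℝ} (hν : -1 < ν) (r : ℤ) :
    besselSeq (q ^ 2) (q ^ (ν + 1)) r * qPochInf (q ^ 2) (q ^ 2) =
      (q ^ (ν + 1)) ^ r * (qPochInf (q ^ (2 * ν + 2)) (q ^ 2) * qBessel q ν (q ^ r)) := by
  have hp0 : 0 < q ^ 2 := by positivity
  have hp1 : q ^ 2 < 1 := pow_lt_one₀ hq0.le hq1 two_ne_zero
  have hσ2 : (q ^ (ν + 1)) ^ 2 = q ^ (2 * ν + 2) := by
    rw [← Real.rpow_mul_natCast hq0.le]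
    push_cast
    ring_nf
  have hx : (q ^ 2) ^ (r + 1) = q ^ 2 * (q ^ r) ^ 2 := by
    rw [zpow_add_one₀ hp0.ne', ← zpow_natCast q 2, zpow_comm, zpow_natCast, mul_comm]
  rw [besselSeq_mul_qPochInf hp0 hp1 (Real.rpow_pos_of_pos hq0 _).ne', hσ2, hx,
    qPochInf_mul_qBessel hq0 hq1 hν]

end

/-! ### The kernel of the Fourier transform -/

/-- The constant `(1 - q) c_{q,v}` in front of the sums over the lattice. -/
noncomputable def kernelConst (q α : ℝ) (n : ℕ) : ℝ := cConst q α n * (1 - q)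

/-- The number `q^{|v|+1}`: the measure `x^{2|v|+1} d_q x` gives the point `q^m` the mass
`(1 - q) (q^{|v|+1})^{2m}`. -/
noncomputable def latticeScale (q α : ℝ) (n : ℕ) : ℝ := q ^ (absV α n + 1)

/-- The sequence `(1 - q) c_{q,v} q^{s(|v|+1)} j̃_{q,v}(q^s, q²)`; its Hankel matrix represents
`F_{q,v}` in the orthonormal basis of multiples of point indicators. -/
noncomputable def kernel (q α : ℝ) (n : ℕ) (s : ℤ) : ℝ :=
  kernelConst q α n * genQBessel q α (-n) (q ^ s) * latticeScale q α n ^ s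

lemma latticeScale_pos {q : ℝ} (hq0 : 0 < q) (α : ℝ) (n : ℕ) : 0 < latticeScale q α n :=
  Real.rpow_pos_of_pos hq0 _

lemma absV_le (α : ℝ) (n : ℕ) : absV α n ≤ α :=
  add_le_of_nonpos_right (neg_nonpos.2 n.cast_nonneg)

section
variable {q : ℝ} (hq0 : 0 < q) (hq1 : q < 1) {α : ℝ} {n : ℕ}
  (hc : qPoch (q ^ (2 * α + 2)) (q ^ 2) n ≠ 0)
include hq0 hq1 hc

lemma kernelConst_mul_qPochInf :
    kernelConst q α n * qPochInf (q ^ 2) (q ^ 2) =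
      (q ^ (α + n + 1)) ^ n * qPochInf (q ^ (2 * (α + n) + 2)) (q ^ 2) := by
  have hp0 : 0 < q ^ 2 := by positivity
  have hp1 : q ^ 2 < 1 := pow_lt_one₀ hq0.le hq1 two_ne_zero
  have hE := qPochInf_self_ne_zero hp0 hp1
  have hq : 1 - q ≠ 0 := (sub_pos.2 hq1).ne'
  have hpow : q ^ ((n : ℝ) * (α + n + 1)) = (q ^ (α + n + 1)) ^ n := by
    rw [mul_comm, Real.rpow_mul_natCast hq0.le]
  have hshift : (q ^ 2) ^ n * q ^ (2 * α + 2) = q ^ (2 * (α + n) + 2) := by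
    rw [← pow_mul, ← Real.rpow_natCast, ← Real.rpow_add hq0]
    push_cast
    ring_nf
  rw [kernelConst, cConst, hpow, qPochInf_eq_qPoch_mul hp0 hp1 (q ^ (2 * α + 2)) n, hshift]
  generalize q ^ (2 * α + 2) = s, q ^ (2 * (α + n) + 2) = s' at *
  field_simp

variable (hν : -1 < α + n)
include hν

lemma kernel_eq_besselSeq (s : ℤ) :
    kernel q α n s = besselSeq (q ^ 2) (q ^ (α + n + 1)) (n + s) := by
  have hE := qPochInf_self_ne_zero (by positivity) (pow_lt_one₀ hq0.le hq1 two_ne_zero)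
  have harg : q ^ (-(-(n : ℝ))) * q ^ s = q ^ ((n : ℤ) + s) := by
    rw [neg_neg, Real.rpow_natCast, zpow_add₀ hq0.ne', zpow_natCast]
  have hscale : (q ^ s) ^ (-2 * -(n : ℝ)) * latticeScale q α n ^ s = (q ^ (α + n + 1)) ^ s := by
    rw [rpow_zpow_comm hq0, latticeScale, ← mul_zpow, ← Real.rpow_add hq0, absV]
    ring_nf
  refine mul_right_cancel₀ hE ?_
  rw [besselSeq_mul_qPochInf_eq_qBessel hq0 hq1 hν, zpow_add₀ (Real.rpow_pos_of_pos hq0 _).ne',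
    zpow_natCast, ← hscale, kernel, genQBessel, harg, sub_neg_eq_add]
  linear_combination (q ^ s) ^ (-2 * -(n : ℝ)) * qBessel q (α + n) (q ^ ((n : ℤ) + s)) *
    latticeScale q α n ^ s * kernelConst_mul_qPochInf hq0 hq1 hc

theorem isOrthogonalHankel_kernel : IsOrthogonalHankel (kernel q α n) := by
  have hσ : |q ^ (α + n + 1)| < 1 := by
    rw [abs_of_pos (Real.rpow_pos_of_pos hq0 _)]
    exact Real.rpow_lt_one hq0.le hq1 (by linarith)
  rw [funext (kernel_eq_besselSeq hq0 hq1 hc hν)]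
  exact (isOrthogonalHankel_besselSeq (by positivity)
    (pow_lt_one₀ hq0.le hq1 two_ne_zero) hσ).comp_add_left n

end

/-! ### Hankel transforms on `ℓ²(ℤ)` -/

section Lp
open scoped ENNReal
variable {ι : Type*}

section
variable {E : Type*} [NormedAddCommGroup E] {u : ι → E}

lemma memℓp_two_iff_summable_sq : Memℓp u 2 ↔ Summable fun i => ‖u i‖ ^ 2 := by
  rw [memℓp_gen_iff (by norm_num)]
  simp only [ENNReal.toReal_ofNat, Real.rpow_two]

lemma memℓp_two_comp_equiv {κ : Type*} (hu : Memℓp u 2) (e : κ ≃ ι) : Memℓp (u ∘ e) 2 :=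
  memℓp_two_iff_summable_sq.2 <| e.summable_iff.2 <| memℓp_two_iff_summable_sq.1 hu

end

variable {𝕜 : Type*} [RCLike 𝕜] {u v : ι → 𝕜}

lemma memℓp_conj {p : ℝ≥0∞} (hu : Memℓp u p) : Memℓp (fun i => conj (u i)) p :=
  hu.star_mem

lemma memℓp_mul {p q r : ℝ≥0∞} [p.HolderTriple q r] (hu : Memℓp u p) (hv : Memℓp v q) :
    Memℓp (fun i => u i * v i) r :=
  hu.holder r hv (fun _ => ContinuousLinearMap.mul 𝕜 𝕜) fun _ =>
    ContinuousLinearMap.opNorm_mul_le 𝕜 𝕜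

lemma memℓp_two_mul (hu : Memℓp u 2) (hv : Memℓp v 2) : Memℓp (fun i => u i * v i) 2 :=
  memℓp_mul (hu.of_exponent_ge le_top) hv

lemma summable_norm_mul (hu : Memℓp u 2) (hv : Memℓp v 2) : Summable fun i => ‖u i * v i‖ := by
  simpa using (memℓp_mul hu hv : Memℓp _ 1).summable (by norm_num)

end Lp

/-- The transform of a sequence by the bilateral Hankel matrix `(h (m + k))`. -/
noncomputable def hankel (h : ℤ → ℝ) (u : ℤ → ℂ) (k : ℤ) : ℂ := ∑' m, u m * (h (m + k) : ℂ)

lemma hankel_const_mul_comp_sub (h : ℤ → ℝ) (u : ℤ → ℂ) (c : ℂ) (i k : ℤ) :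
    hankel h (fun m => c * u (m - i)) k = c * hankel h u (i + k) := by
  rw [hankel, hankel, ← (Equiv.addRight i).tsum_eq, ← tsum_mul_left]
  simp only [Equiv.coe_addRight, add_sub_cancel_right, mul_assoc, add_assoc]

namespace IsOrthogonalHankel
variable {h : ℤ → ℝ} (hh : IsOrthogonalHankel h)
include hh

lemma memℓp_row (k : ℤ) : Memℓp (fun m => (h (m + k) : ℂ)) 2 := by
  refine memℓp_two_iff_summable_sq.2 ((hh k k).summable.congr fun m => ?_)
  rw [Complex.norm_real, Real.norm_eq_abs, sq_abs, sq]

/-- The `k`-th row of an orthogonal Hankel matrix as an element of `ℓ²(ℤ)`. -/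
noncomputable def row (k : ℤ) : lp (fun _ : ℤ => ℂ) 2 := ⟨_, hh.memℓp_row k⟩

lemma orthonormal_row : Orthonormal ℂ hh.row := by
  refine orthonormal_iff_ite.2 fun k l => (lp.hasSum_inner _ _).unique ?_
  have hsum := Complex.hasSum_ofReal.2 (hh k l)
  rw [apply_ite Complex.ofReal, Complex.ofReal_one, Complex.ofReal_zero] at hsum
  simpa [row, mul_comm] using hsum

/-- The Hankel transform of an orthogonal Hankel matrix as a linear isometry of `ℓ²(ℤ)`. -/
noncomputable def isometry : lp (fun _ : ℤ => ℂ) 2 →ₗᵢ[ℂ] lp (fun _ : ℤ => ℂ) 2 :=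
  hh.orthonormal_row.orthogonalFamily.linearIsometry

lemma isometry_apply (u : lp (fun _ : ℤ => ℂ) 2) (k : ℤ) : hh.isometry u k = hankel h u k := by
  have hsum := (hh.orthonormal_row.orthogonalFamily.hasSum_linearIsometry u).mapL
    (lp.evalCLM ℂ (fun _ : ℤ => ℂ) 2 k)
  refine hsum.tsum_eq.symm.trans (tsum_congr fun m => ?_)
  change u m * (h (k + m) : ℂ) = u m * (h (m + k) : ℂ)
  rw [add_comm]

lemma isometry_single (k : ℤ) : hh.isometry (lp.single 2 k 1) = hh.row k := by
  rw [isometry, OrthogonalFamily.linearIsometry_apply_single, LinearIsometry.toSpanSingleton_apply,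
    one_smul]

variable {u v : ℤ → ℂ} (hu : Memℓp u 2) (hv : Memℓp v 2)
include hu

lemma memℓp_hankel : Memℓp (hankel h u) 2 := by
  rw [← funext (hh.isometry_apply ⟨u, hu⟩)]
  exact lp.memℓp _

lemma hankel_hankel : hankel h (hankel h u) = u := by
  ext k
  have hinner := hh.isometry.inner_map_map (lp.single 2 k 1) ⟨u, hu⟩
  rw [isometry_single, lp.inner_single_left (𝕜 := ℂ) (G := fun _ : ℤ => ℂ), lp.inner_eq_tsum]
    at hinner
  simpa [hankel, row, isometry_apply] using hinner

include hv

lemma tsum_hankel_mul_conj :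
    ∑' k, hankel h u k * conj (hankel h v k) = ∑' m, u m * conj (v m) := by
  simpa only [isometry_apply, lp.inner_eq_tsum, RCLike.inner_apply] using
    hh.isometry.inner_map_map ⟨v, hv⟩ ⟨u, hu⟩

lemma tsum_mul_conj_hankel :
    ∑' m, u m * conj (hankel h v m) = ∑' k, hankel h u k * conj (v k) := by
  rw [← hh.tsum_hankel_mul_conj hu (hh.memℓp_hankel hv), hh.hankel_hankel hv]

omit hv

lemma tsum_norm_sq_hankel : ∑' k, ‖hankel h u k‖ ^ 2 = ∑' m, ‖u m‖ ^ 2 := by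
  have hsum := hh.tsum_hankel_mul_conj hu hu
  simp only [Complex.mul_conj'] at hsum
  exact_mod_cast hsum

end IsOrthogonalHankel

lemma hasSum_mul_add {G R : Type*} [AddGroup G] [NormedRing R] [CompleteSpace R] {a b : G → R}
    (ha : Summable fun k => ‖a k‖) (hb : Summable fun k => ‖b k‖) :
    HasSum (fun x : G × G => a x.2 * b (x.1 + x.2)) ((∑' k, a k) * ∑' k, b k) := by
  have hprod : HasSum (fun x : G × G => a x.1 * b x.2) ((∑' k, a k) * ∑' k, b k) := by
    rw [tsum_mul_tsum_of_summable_norm ha hb]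
    exact (summable_mul_of_summable_norm ha hb).hasSum
  exact ((Equiv.prodComm G G).trans
    (Equiv.prodShear (Equiv.refl G) Equiv.addRight)).hasSum_iff.2 hprod

/-- The wavelet transform of `u` on the lattice up to normalization, at the scale `i` and the
position `j`, for a wavelet with Fourier transform `P`. -/
noncomputable def hankelWavelet (h : ℤ → ℝ) (P u : ℤ → ℂ) (i : ℤ) : ℤ → ℂ :=
  hankel h fun k => hankel h u k * conj (P (i + k))

namespace IsOrthogonalHankel
variable {h : ℤ → ℝ} (hh : IsOrthogonalHankel h) {P u v : ℤ → ℂ} (hP : Memℓp P 2)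
  (hu : Memℓp u 2) (hv : Memℓp v 2)
include hh hP hu

lemma memℓp_hankel_mul_conj (i : ℤ) : Memℓp (fun k => hankel h u k * conj (P (i + k))) 2 :=
  memℓp_two_mul (hh.memℓp_hankel hu) (memℓp_conj (memℓp_two_comp_equiv hP (Equiv.addLeft i)))

lemma memℓp_hankelWavelet_row (i : ℤ) : Memℓp (hankelWavelet h P u i) 2 :=
  hh.memℓp_hankel (hh.memℓp_hankel_mul_conj hP hu i)

lemma tsum_norm_sq_hankelWavelet_row (i : ℤ) :
    ∑' j, ‖hankelWavelet h P u i j‖ ^ 2 = ∑' k, ‖hankel h u k‖ ^ 2 * ‖P (i + k)‖ ^ 2 := by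
  refine (hh.tsum_norm_sq_hankel (hh.memℓp_hankel_mul_conj hP hu i)).trans ?_
  simp only [norm_mul, Complex.norm_conj, mul_pow]

lemma memℓp_hankelWavelet : Memℓp (fun x : ℤ × ℤ => hankelWavelet h P u x.1 x.2) 2 := by
  rw [memℓp_two_iff_summable_sq, summable_prod_of_nonneg fun _ => sq_nonneg _]
  refine ⟨fun i => memℓp_two_iff_summable_sq.1 (hh.memℓp_hankelWavelet_row hP hu i), ?_⟩
  simp only [hh.tsum_norm_sq_hankelWavelet_row hP hu]
  exact (hasSum_mul_add (memℓp_two_iff_summable_sq.1 (hh.memℓp_hankel hu)).norm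
    (memℓp_two_iff_summable_sq.1 hP).norm).summable.prod

include hv

theorem hasSum_hankelWavelet_mul_conj :
    HasSum (fun x : ℤ × ℤ => hankelWavelet h P u x.1 x.2 * conj (hankelWavelet h P v x.1 x.2))
      ((∑' m, u m * conj (v m)) * ((∑' i, ‖P i‖ ^ 2 : ℝ) : ℂ)) := by
  have hsum := (summable_norm_mul (hh.memℓp_hankelWavelet hP hu)
    (memℓp_conj (hh.memℓp_hankelWavelet hP hv))).of_norm
  have hrow (i : ℤ) : ∑' j, hankelWavelet h P u i j * conj (hankelWavelet h P v i j) =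
      ∑' k, hankel h u k * conj (hankel h v k) * ((‖P (i + k)‖ ^ 2 : ℝ) : ℂ) := by
    refine (hh.tsum_hankel_mul_conj (hh.memℓp_hankel_mul_conj hP hu i)
      (hh.memℓp_hankel_mul_conj hP hv i)).trans (tsum_congr fun k => ?_)
    rw [map_mul, Complex.conj_conj, Complex.ofReal_pow, ← Complex.conj_mul']
    ring
  have hshear := hasSum_mul_add
    (summable_norm_mul (hh.memℓp_hankel hu) (memℓp_conj (hh.memℓp_hankel hv)))
    (b := fun i => ((‖P i‖ ^ 2 : ℝ) : ℂ)) (by simpa using memℓp_two_iff_summable_sq.1 hP)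
  rw [hh.tsum_hankel_mul_conj hu hv, ← Complex.ofReal_tsum] at hshear
  rw [← hshear.tsum_eq, hshear.summable.tsum_prod, ← tsum_congr hrow, ← hsum.tsum_prod]
  exact hsum.hasSum

end IsOrthogonalHankel

/-! ### The passage to the lattice -/

/-- The isometry from `L_{q,2,v}` to `ℓ²(ℤ)`, up to the factor `√(1 - q)` in the norms. -/
noncomputable def latticeSeq (q α : ℝ) (n : ℕ) (f : ℝ → ℂ) (m : ℤ) : ℂ :=
  f (q ^ m) * ((latticeScale q α n ^ m : ℝ) : ℂ)

section
variable {q : ℝ} (hq0 : 0 < q) (α : ℝ) (n : ℕ)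
include hq0

lemma ofReal_zpow_ne_zero (m : ℤ) : ((q ^ m : ℝ) : ℂ) ≠ 0 :=
  Complex.ofReal_ne_zero.2 (zpow_pos hq0 m).ne'

lemma ofReal_latticeScale_zpow_ne_zero (m : ℤ) : ((latticeScale q α n ^ m : ℝ) : ℂ) ≠ 0 :=
  ofReal_zpow_ne_zero (latticeScale_pos hq0 α n) m

lemma ofReal_latticeScale_zpow_add (k m : ℤ) : ((latticeScale q α n ^ (k + m) : ℝ) : ℂ) =
    ((latticeScale q α n ^ k : ℝ) : ℂ) * ((latticeScale q α n ^ m : ℝ) : ℂ) := by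
  rw [zpow_add₀ (latticeScale_pos hq0 α n).ne', Complex.ofReal_mul]

lemma zpow_rpow_eq_latticeScale_sq (m : ℤ) :
    (q ^ m) ^ (2 * absV α n + 2) = (latticeScale q α n ^ m) ^ 2 := by
  rw [rpow_zpow_comm hq0, latticeScale, sq, ← mul_zpow, ← Real.rpow_add hq0]
  ring_nf

lemma weight_zpow (m : ℤ) : weight α n (q ^ m) = (latticeScale q α n ^ m) ^ 2 / q ^ m := by
  have hm := zpow_pos hq0 m
  rw [eq_div_iff hm.ne', ← zpow_rpow_eq_latticeScale_sq hq0, weight, ← Real.rpow_add_one hm.ne']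
  ring_nf

lemma zpow_smul_norm_rpow_mul_weight (f : ℝ → ℂ) (m : ℤ) :
    q ^ m • (‖f (q ^ m)‖ ^ (2 : ℝ) * weight α n (q ^ m)) = ‖latticeSeq q α n f m‖ ^ 2 := by
  have hm := (zpow_pos hq0 m).ne'
  rw [weight_zpow hq0, latticeSeq, norm_mul, mul_pow, Complex.norm_real, Real.norm_eq_abs, sq_abs,
    smul_eq_mul, Real.rpow_two]
  field_simp

lemma zpow_smul_mul_conj_mul_weight (f g : ℝ → ℂ) (m : ℤ) :
    q ^ m • (f (q ^ m) * conj (g (q ^ m)) * (weight α n (q ^ m) : ℂ)) =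
      latticeSeq q α n f m * conj (latticeSeq q α n g m) := by
  have hm := ofReal_zpow_ne_zero hq0 m
  rw [weight_zpow hq0, latticeSeq, latticeSeq, map_mul, Complex.conj_ofReal, Complex.real_smul,
    Complex.ofReal_div, Complex.ofReal_pow]
  field_simp

lemma memLq_two_iff (f : ℝ → ℂ) : MemLq q 2 α n f ↔ Memℓp (latticeSeq q α n f) 2 := by
  simp only [MemLq, QIntegrable, zpow_smul_norm_rpow_mul_weight hq0, norm_pow, norm_norm,
    memℓp_two_iff_summable_sq]

lemma latticeSeq_dilate (Ψ : ℝ → ℂ) (i m : ℤ) :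
    latticeSeq q α n (dilate α n Ψ (q ^ i)) m =
      ((latticeScale q α n ^ i : ℝ) : ℂ)⁻¹ * latticeSeq q α n Ψ (m - i) := by
  have hi := ofReal_latticeScale_zpow_ne_zero hq0 α n i
  rw [latticeSeq, latticeSeq, dilate, zpow_rpow_eq_latticeScale_sq hq0, ← zpow_sub₀ hq0.ne',
    zpow_sub₀ (latticeScale_pos hq0 α n).ne', Complex.ofReal_div, Complex.ofReal_div,
    Complex.ofReal_pow, Complex.ofReal_one]
  field_simp

end

section
variable {q : ℝ} (hq0 : 0 < q) {α : ℝ} {n : ℕ}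
include hq0

lemma memLq_dilate {Ψ : ℝ → ℂ} (hΨ : MemLq q 2 α n Ψ) (i : ℤ) :
    MemLq q 2 α n (dilate α n Ψ (q ^ i)) := by
  rw [memLq_two_iff hq0, funext (latticeSeq_dilate hq0 α n Ψ i)]
  exact (memℓp_two_comp_equiv ((memLq_two_iff hq0 α n Ψ).1 hΨ) (Equiv.subRight i)).const_mul _

lemma zpow_smul_fourierIntegrand (f : ℝ → ℂ) (k m : ℤ) :
    ((kernelConst q α n * latticeScale q α n ^ k : ℝ) : ℂ) *
        q ^ m • fourierIntegrand q α n f (q ^ k) (q ^ m) =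
      latticeSeq q α n f m * (kernel q α n (m + k) : ℂ) := by
  have hm := ofReal_zpow_ne_zero hq0 m
  rw [fourierIntegrand, latticeSeq, kernel, weight_zpow hq0, ← zpow_add₀ hq0.ne',
    Complex.real_smul]
  simp only [Complex.ofReal_div, Complex.ofReal_mul, Complex.ofReal_pow,
    ofReal_latticeScale_zpow_add hq0]
  field_simp

lemma latticeSeq_fourier (f : ℝ → ℂ) :
    latticeSeq q α n (fourier q α n f) = hankel (kernel q α n) (latticeSeq q α n f) := by
  ext k
  simp only [hankel, ← zpow_smul_fourierIntegrand hq0, tsum_mul_left]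
  rw [latticeSeq, fourier, qIntegral, kernelConst, Complex.real_smul]
  simp only [Complex.ofReal_mul]
  ring

lemma fourier_dilate (Ψ : ℝ → ℂ) (i k : ℤ) :
    fourier q α n (dilate α n Ψ (q ^ i)) (q ^ k) = fourier q α n Ψ (q ^ (i + k)) := by
  have hi := ofReal_latticeScale_zpow_ne_zero hq0 α n i
  refine mul_right_cancel₀ (ofReal_latticeScale_zpow_ne_zero hq0 α n k) ?_
  calc fourier q α n (dilate α n Ψ (q ^ i)) (q ^ k) * ((latticeScale q α n ^ k : ℝ) : ℂ)
      = hankel (kernel q α n) (latticeSeq q α n (dilate α n Ψ (q ^ i))) k :=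
        congrFun (latticeSeq_fourier hq0 _) k
    _ = ((latticeScale q α n ^ i : ℝ) : ℂ)⁻¹ *
          hankel (kernel q α n) (latticeSeq q α n Ψ) (i + k) := by
        rw [funext (latticeSeq_dilate hq0 α n Ψ i), hankel_const_mul_comp_sub]
    _ = fourier q α n Ψ (q ^ (i + k)) * ((latticeScale q α n ^ k : ℝ) : ℂ) := by
        rw [← latticeSeq_fourier hq0, latticeSeq, ofReal_latticeScale_zpow_add hq0]
        field_simp

lemma zpow_smul_translationIntegrand (g : ℝ → ℂ) (j k m : ℤ) :
    ((kernelConst q α n ^ 2 * latticeScale q α n ^ j * latticeScale q α n ^ m : ℝ) : ℂ) *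
        q ^ k • translationIntegrand q α n (q ^ j) g (q ^ m) (q ^ k) =
      fourier q α n g (q ^ k) * (kernel q α n (k + j) : ℂ) * (kernel q α n (k + m) : ℂ) := by
  have hk := ofReal_zpow_ne_zero hq0 k
  rw [translationIntegrand, kernel, kernel, weight_zpow hq0, ← zpow_add₀ hq0.ne',
    ← zpow_add₀ hq0.ne', add_comm m, add_comm j, Complex.real_smul]
  simp only [Complex.ofReal_div, Complex.ofReal_mul, Complex.ofReal_pow,
    ofReal_latticeScale_zpow_add hq0]
  field_simp

lemma latticeSeq_translation (g : ℝ → ℂ) (j m : ℤ) :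
    ((kernelConst q α n * latticeScale q α n ^ j : ℝ) : ℂ) *
        latticeSeq q α n (translation q α n (q ^ j) g) m =
      hankel (kernel q α n) (fun k => fourier q α n g (q ^ k) * (kernel q α n (k + j) : ℂ)) m := by
  simp only [hankel, ← zpow_smul_translationIntegrand hq0, tsum_mul_left]
  rw [latticeSeq, translation, qIntegral, kernelConst, Complex.real_smul]
  simp only [Complex.ofReal_mul, Complex.ofReal_pow]
  ring

lemma latticeSeq_waveletCopy (Ψ : ℝ → ℂ) (i j m : ℤ) :
    ((kernelConst q α n * latticeScale q α n ^ j : ℝ) : ℂ) *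
        latticeSeq q α n (waveletCopy q α n Ψ (q ^ i) (q ^ j)) m =
      (√(q ^ i) : ℂ) * hankel (kernel q α n)
        (fun k => fourier q α n Ψ (q ^ (i + k)) * (kernel q α n (k + j) : ℂ)) m := by
  simp only [← fourier_dilate hq0, ← latticeSeq_translation hq0]
  rw [latticeSeq, latticeSeq, waveletCopy]
  ring

end

/-! ### Convergence of the integrals -/

lemma IsOrthogonalHankel.kernelConst_ne_zero {q α : ℝ} {n : ℕ}
    (hK : IsOrthogonalHankel (kernel q α n)) : kernelConst q α n ≠ 0 := by
  intro hzero
  have hrow := hK 0 0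
  simp only [kernel, hzero, zero_mul, if_true] at hrow
  exact zero_ne_one (hasSum_zero.unique hrow)

section
variable {q : ℝ} (hq0 : 0 < q) {α : ℝ} {n : ℕ}
include hq0

lemma admissible_iff (Ψ : ℝ → ℂ) :
    (QIntegrable q fun a => ‖fourier q α n Ψ a‖ ^ 2 / a) ↔
      Memℓp (fun m : ℤ => fourier q α n Ψ (q ^ m)) 2 := by
  simp only [QIntegrable, smul_eq_mul, mul_div_cancel₀ _ (zpow_pos hq0 _).ne', norm_pow, norm_norm,
    memℓp_two_iff_summable_sq]

lemma admConst_eq (Ψ : ℝ → ℂ) :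
    admConst q α n Ψ = (1 - q) * ∑' m : ℤ, ‖fourier q α n Ψ (q ^ m)‖ ^ 2 := by
  simp only [admConst, qIntegral, smul_eq_mul, mul_div_cancel₀ _ (zpow_pos hq0 _).ne']

lemma memℓp_fourier_dilate {Ψ : ℝ → ℂ} (hP : Memℓp (fun m : ℤ => fourier q α n Ψ (q ^ m)) 2)
    (i : ℤ) : Memℓp (fun m : ℤ => fourier q α n (dilate α n Ψ (q ^ i)) (q ^ m)) 2 := by
  simp only [fourier_dilate hq0]
  exact memℓp_two_comp_equiv hP (Equiv.addLeft i)

lemma qIntegrable_mul_conj_mul_weight {f g : ℝ → ℂ} (hf : MemLq q 2 α n f)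
    (hg : MemLq q 2 α n g) :
    QIntegrable q fun x => f x * conj (g x) * (weight α n x : ℂ) := by
  simp only [QIntegrable, zpow_smul_mul_conj_mul_weight hq0]
  exact summable_norm_mul ((memLq_two_iff hq0 α n f).1 hf)
    (memℓp_conj ((memLq_two_iff hq0 α n g).1 hg))

variable (hK : IsOrthogonalHankel (kernel q α n))
include hK

lemma apply_zpow_eq_zero_of_fourier_eq_zero {f : ℝ → ℂ} (hf : MemLq q 2 α n f)
    (hzero : ∀ k : ℤ, fourier q α n f (q ^ k) = 0) (m : ℤ) : f (q ^ m) = 0 := by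
  have hhankel : hankel (kernel q α n) (latticeSeq q α n f) = 0 := by
    ext k
    rw [← latticeSeq_fourier hq0, latticeSeq, hzero, zero_mul, Pi.zero_apply]
  have hinv := congrFun (hK.hankel_hankel ((memLq_two_iff hq0 α n f).1 hf)) m
  rw [hhankel] at hinv
  simp only [hankel, Pi.zero_apply, zero_mul, tsum_zero] at hinv
  exact (mul_eq_zero.1 hinv.symm).resolve_right (ofReal_latticeScale_zpow_ne_zero hq0 α n m)

lemma admConst_pos (hq1 : q < 1) {Ψ : ℝ → ℂ} (hΨ : MemLq q 2 α n Ψ)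
    (hadm : QIntegrable q fun a => ‖fourier q α n Ψ a‖ ^ 2 / a)
    (hΨ0 : ∃ x ∈ lattice q, Ψ x ≠ 0) : 0 < admConst q α n Ψ := by
  obtain ⟨_, ⟨m, rfl⟩, hm⟩ := hΨ0
  obtain ⟨k, hk⟩ : ∃ k : ℤ, fourier q α n Ψ (q ^ k) ≠ 0 := by
    by_contra! hzero
    exact hm (apply_zpow_eq_zero_of_fourier_eq_zero hq0 hK hΨ hzero m)
  have hsum := memℓp_two_iff_summable_sq.1 ((admissible_iff hq0 Ψ).1 hadm)
  rw [admConst_eq hq0]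
  exact mul_pos (sub_pos.2 hq1) (hsum.tsum_pos (fun _ => by positivity) k (by positivity))

lemma ofReal_kernelConst_mul_latticeScale_zpow_ne_zero (k : ℤ) :
    ((kernelConst q α n * latticeScale q α n ^ k : ℝ) : ℂ) ≠ 0 :=
  Complex.ofReal_ne_zero.2
    (mul_ne_zero hK.kernelConst_ne_zero (zpow_pos (latticeScale_pos hq0 α n) k).ne')

lemma qIntegrable_fourierIntegrand {f : ℝ → ℂ} (hf : MemLq q 2 α n f) (k : ℤ) :
    QIntegrable q (fourierIntegrand q α n f (q ^ k)) := by
  have hc := ofReal_kernelConst_mul_latticeScale_zpow_ne_zero hq0 hK k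
  have hsum := summable_norm_mul ((memLq_two_iff hq0 α n f).1 hf) (hK.memℓp_row k)
  simp only [← zpow_smul_fourierIntegrand hq0] at hsum
  simp only [norm_mul _ (_ • _)] at hsum
  exact (summable_mul_left_iff (norm_ne_zero_iff.2 hc)).1 hsum

section
variable {g : ℝ → ℂ} (hg : Memℓp (fun k : ℤ => fourier q α n g (q ^ k)) 2)
include hg

lemma qIntegrable_translationIntegrand (j m : ℤ) :
    QIntegrable q (translationIntegrand q α n (q ^ j) g (q ^ m)) := by
  have hscale := latticeScale_pos hq0 α n
  have hconst := hK.kernelConst_ne_zero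
  have hc : kernelConst q α n ^ 2 * latticeScale q α n ^ j * latticeScale q α n ^ m ≠ 0 := by
    positivity
  have hsum := summable_norm_mul (memℓp_two_mul hg (hK.memℓp_row j)) (hK.memℓp_row m)
  simp only [← zpow_smul_translationIntegrand hq0] at hsum
  simp only [norm_mul _ (_ • _)] at hsum
  exact (summable_mul_left_iff (norm_ne_zero_iff.2 (Complex.ofReal_ne_zero.2 hc))).1 hsum

lemma memLq_translation (j : ℤ) : MemLq q 2 α n (translation q α n (q ^ j) g) := by
  have hc := ofReal_kernelConst_mul_latticeScale_zpow_ne_zero hq0 hK j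
  rw [memLq_two_iff hq0, funext fun m =>
    (eq_inv_mul_iff_mul_eq₀ hc).2 (latticeSeq_translation hq0 g j m)]
  exact (hK.memℓp_hankel (memℓp_two_mul hg (hK.memℓp_row j))).const_mul _

end

variable {Ψ : ℝ → ℂ} (hP : Memℓp (fun m : ℤ => fourier q α n Ψ (q ^ m)) 2)
include hP

lemma memLq_waveletCopy (i j : ℤ) : MemLq q 2 α n (waveletCopy q α n Ψ (q ^ i) (q ^ j)) := by
  have hT := (memLq_two_iff hq0 α n _).1
    (memLq_translation hq0 hK (memℓp_fourier_dilate hq0 hP i) j)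
  have hcopy : latticeSeq q α n (waveletCopy q α n Ψ (q ^ i) (q ^ j)) = fun m =>
      (√(q ^ i) : ℂ) *
        latticeSeq q α n (translation q α n (q ^ j) (dilate α n Ψ (q ^ i))) m := by
    ext m
    simp only [latticeSeq, waveletCopy, mul_assoc]
  rw [memLq_two_iff hq0, hcopy]
  exact hT.const_mul _

lemma qIntegrable_waveletIntegrand {f : ℝ → ℂ} (hf : MemLq q 2 α n f) (i j : ℤ) :
    QIntegrable q (waveletIntegrand q α n Ψ f (q ^ i) (q ^ j)) :=
  qIntegrable_mul_conj_mul_weight hq0 hf (memLq_waveletCopy hq0 hK hP i j)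

/-! ### The Parseval and Plancherel formulas -/

lemma waveletTransform_zpow {f : ℝ → ℂ} (hf : MemLq q 2 α n f) (i j : ℤ) :
    ((latticeScale q α n ^ j : ℝ) : ℂ) * waveletTransform q α n Ψ f (q ^ i) (q ^ j) =
      (√(q ^ i) : ℂ) * hankelWavelet (kernel q α n) (fun m => fourier q α n Ψ (q ^ m))
        (latticeSeq q α n f) i j := by
  let v (k : ℤ) : ℂ := fourier q α n Ψ (q ^ (i + k)) * (kernel q α n (k + j) : ℂ)
  have hv : Memℓp v 2 :=
    memℓp_two_mul (memℓp_two_comp_equiv hP (Equiv.addLeft i)) (hK.memℓp_row j)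
  calc ((latticeScale q α n ^ j : ℝ) : ℂ) * waveletTransform q α n Ψ f (q ^ i) (q ^ j)
      = ∑' m, latticeSeq q α n f m *
          conj (((kernelConst q α n * latticeScale q α n ^ j : ℝ) : ℂ) *
            latticeSeq q α n (waveletCopy q α n Ψ (q ^ i) (q ^ j)) m) := by
        simp only [waveletTransform, qIntegral, waveletIntegrand,
          zpow_smul_mul_conj_mul_weight hq0, map_mul, Complex.conj_ofReal,
          mul_left_comm (latticeSeq q α n f _), tsum_mul_left]
        simp only [kernelConst, Complex.real_smul, Complex.ofReal_mul]
        ring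
    _ = (√(q ^ i) : ℂ) * ∑' m, latticeSeq q α n f m * conj (hankel (kernel q α n) v m) := by
        simp only [latticeSeq_waveletCopy hq0, map_mul, Complex.conj_ofReal,
          mul_left_comm (latticeSeq q α n f _), tsum_mul_left, v]
    _ = (√(q ^ i) : ℂ) * ∑' k, hankel (kernel q α n) (latticeSeq q α n f) k * conj (v k) := by
        rw [hK.tsum_mul_conj_hankel ((memLq_two_iff hq0 α n f).1 hf) hv]
    _ = _ := by
        simp only [v, hankelWavelet, map_mul, Complex.conj_ofReal, ← mul_assoc]
        rfl

end

/-- The integrand of the right-hand side of Parseval's formula. -/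
noncomputable def parsevalIntegrand (q α : ℝ) (n : ℕ) (Ψ f g : ℝ → ℂ) (a b : ℝ) : ℂ :=
  waveletTransform q α n Ψ f a b * conj (waveletTransform q α n Ψ g a b) * (weight α n b : ℂ) /
    (a : ℂ) ^ 2

lemma qIntegral₂_eq_tsum {E : Type*} [NormedAddCommGroup E] [NormedSpace ℝ E] [CompleteSpace E]
    {q : ℝ} {F : ℝ → ℝ → E} (hF : QIntegrable₂ q F) :
    qIntegral₂ q F =
      (1 - q) ^ 2 • ∑' x : ℤ × ℤ, (q ^ x.1 * q ^ x.2) • F (q ^ x.1) (q ^ x.2) := by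
  have hsum : Summable fun x : ℤ × ℤ => (q ^ x.1 * q ^ x.2) • F (q ^ x.2) (q ^ x.1) := by
    simpa only [Function.comp_def, Equiv.prodComm_apply, Prod.fst_swap, Prod.snd_swap, mul_comm]
      using (Equiv.prodComm ℤ ℤ).summable_iff.2 (Summable.of_norm hF)
  calc qIntegral₂ q F
      = (1 - q) ^ 2 • ∑' (j : ℤ) (i : ℤ), (q ^ j * q ^ i) • F (q ^ i) (q ^ j) := by
        simp only [qIntegral₂, qIntegral, sq, smul_comm (q ^ (_ : ℤ)) (1 - q), mul_smul,
          tsum_const_smul'']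
    _ = (1 - q) ^ 2 • ∑' x : ℤ × ℤ, (q ^ x.1 * q ^ x.2) • F (q ^ x.2) (q ^ x.1) := by
        rw [hsum.tsum_prod]
    _ = _ := by
        rw [← (Equiv.prodComm ℤ ℤ).tsum_eq]
        simp only [Equiv.prodComm_apply, Prod.fst_swap, Prod.snd_swap, mul_comm]

lemma qIntegral_ofReal (q : ℝ) (f : ℝ → ℝ) :
    qIntegral q (fun x => (f x : ℂ)) = ((qIntegral q f : ℝ) : ℂ) := by
  simp only [qIntegral, Complex.real_smul, smul_eq_mul, Complex.ofReal_mul, Complex.ofReal_tsum]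

lemma qIntegral₂_ofReal (q : ℝ) (F : ℝ → ℝ → ℝ) :
    qIntegral₂ q (fun a b => (F a b : ℂ)) = ((qIntegral₂ q F : ℝ) : ℂ) := by
  simp only [qIntegral₂, qIntegral_ofReal]

lemma qIntegrable₂_ofReal_iff (q : ℝ) (F : ℝ → ℝ → ℝ) :
    QIntegrable₂ q (fun a b => (F a b : ℂ)) ↔ QIntegrable₂ q F := by
  simp only [QIntegrable₂, norm_smul, Complex.norm_real]

lemma ofReal_norm_sq_waveletTransform (q α : ℝ) (n : ℕ) (Ψ f : ℝ → ℂ) (a b : ℝ) :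
    ((‖waveletTransform q α n Ψ f a b‖ ^ 2 * weight α n b / a ^ 2 : ℝ) : ℂ) =
      parsevalIntegrand q α n Ψ f f a b := by
  rw [parsevalIntegrand, Complex.mul_conj']
  push_cast
  rfl

section
variable {q : ℝ} (hq0 : 0 < q) {α : ℝ} {n : ℕ}
include hq0

lemma qIntegral_mul_conj_mul_weight (f g : ℝ → ℂ) :
    qIntegral q (fun x => f x * conj (g x) * (weight α n x : ℂ)) =
      ((1 - q : ℝ) : ℂ) * ∑' m, latticeSeq q α n f m * conj (latticeSeq q α n g m) := by
  simp only [qIntegral, zpow_smul_mul_conj_mul_weight hq0, Complex.real_smul]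

lemma ofReal_normLq_two_sq (hq1 : q < 1) (f : ℝ → ℂ) :
    ((normLq q 2 α n f ^ 2 : ℝ) : ℂ) =
      qIntegral q fun x => f x * conj (f x) * (weight α n x : ℂ) := by
  have hnonneg : 0 ≤ qIntegral q fun x => ‖f x‖ ^ (2 : ℝ) * weight α n x := by
    simp only [qIntegral, zpow_smul_norm_rpow_mul_weight hq0]
    exact mul_nonneg (sub_pos.2 hq1).le (tsum_nonneg fun _ => sq_nonneg _)
  rw [normLq, ← Real.sqrt_eq_rpow, Real.sq_sqrt hnonneg, ← qIntegral_ofReal]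
  simp only [Complex.mul_conj', Complex.ofReal_mul, Real.rpow_two, Complex.ofReal_pow]

variable (hK : IsOrthogonalHankel (kernel q α n)) {Ψ : ℝ → ℂ}
  (hadm : QIntegrable q fun a => ‖fourier q α n Ψ a‖ ^ 2 / a) {f g : ℝ → ℂ}
  (hf : MemLq q 2 α n f) (hg : MemLq q 2 α n g)
include hK hadm hf hg

lemma smul_parsevalIntegrand_zpow (i j : ℤ) :
    (q ^ i * q ^ j) • parsevalIntegrand q α n Ψ f g (q ^ i) (q ^ j) =
      hankelWavelet (kernel q α n) (fun m => fourier q α n Ψ (q ^ m)) (latticeSeq q α n f) i j *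
        conj (hankelWavelet (kernel q α n) (fun m => fourier q α n Ψ (q ^ m))
          (latticeSeq q α n g) i j) := by
  have hP := (admissible_iff hq0 Ψ).1 hadm
  have hi := ofReal_zpow_ne_zero hq0 i
  have hj := ofReal_zpow_ne_zero hq0 j
  have hsqrt : (√(q ^ i) : ℂ) * √(q ^ i) = ((q ^ i : ℝ) : ℂ) := by
    rw [← Complex.ofReal_mul, Real.mul_self_sqrt (zpow_pos hq0 i).le]
  have hG := congrArg conj (waveletTransform_zpow hq0 hK hP hg i j)
  simp only [map_mul, Complex.conj_ofReal] at hG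
  calc (q ^ i * q ^ j) • parsevalIntegrand q α n Ψ f g (q ^ i) (q ^ j)
      = ((latticeScale q α n ^ j : ℝ) : ℂ) * waveletTransform q α n Ψ f (q ^ i) (q ^ j) *
          (((latticeScale q α n ^ j : ℝ) : ℂ) *
            conj (waveletTransform q α n Ψ g (q ^ i) (q ^ j))) / ((q ^ i : ℝ) : ℂ) := by
        rw [parsevalIntegrand, weight_zpow hq0, Complex.real_smul]
        simp only [Complex.ofReal_div, Complex.ofReal_mul, Complex.ofReal_pow]
        field_simp
    _ = _ := by
        rw [waveletTransform_zpow hq0 hK hP hf, hG, mul_mul_mul_comm, hsqrt,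
          mul_div_cancel_left₀ _ hi]

lemma hasSum_smul_parsevalIntegrand :
    HasSum (fun x : ℤ × ℤ => (q ^ x.1 * q ^ x.2) •
        parsevalIntegrand q α n Ψ f g (q ^ x.1) (q ^ x.2))
      ((∑' m, latticeSeq q α n f m * conj (latticeSeq q α n g m)) *
        ((∑' m : ℤ, ‖fourier q α n Ψ (q ^ m)‖ ^ 2 : ℝ) : ℂ)) := by
  simp only [smul_parsevalIntegrand_zpow hq0 hK hadm hf hg]
  exact hK.hasSum_hankelWavelet_mul_conj ((admissible_iff hq0 Ψ).1 hadm)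
    ((memLq_two_iff hq0 α n f).1 hf) ((memLq_two_iff hq0 α n g).1 hg)

lemma qIntegrable₂_parsevalIntegrand : QIntegrable₂ q (parsevalIntegrand q α n Ψ f g) :=
  (hasSum_smul_parsevalIntegrand hq0 hK hadm hf hg).summable.norm

theorem qIntegral₂_parsevalIntegrand :
    qIntegral₂ q (parsevalIntegrand q α n Ψ f g) = (admConst q α n Ψ : ℂ) *
      qIntegral q fun x => f x * conj (g x) * (weight α n x : ℂ) := by
  rw [qIntegral₂_eq_tsum (qIntegrable₂_parsevalIntegrand hq0 hK hadm hf hg),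
    (hasSum_smul_parsevalIntegrand hq0 hK hadm hf hg).tsum_eq, admConst_eq hq0,
    qIntegral_mul_conj_mul_weight hq0, Complex.real_smul, Complex.ofReal_pow, Complex.ofReal_mul]
  ring

omit hg

lemma qIntegrable₂_norm_sq_waveletTransform :
    QIntegrable₂ q fun a b => ‖waveletTransform q α n Ψ f a b‖ ^ 2 * weight α n b / a ^ 2 := by
  rw [← qIntegrable₂_ofReal_iff]
  simp only [ofReal_norm_sq_waveletTransform]
  exact qIntegrable₂_parsevalIntegrand hq0 hK hadm hf hf

theorem qIntegral₂_norm_sq_waveletTransform (hq1 : q < 1) :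
    (qIntegral₂ q fun a b => ‖waveletTransform q α n Ψ f a b‖ ^ 2 * weight α n b / a ^ 2) =
      admConst q α n Ψ * normLq q 2 α n f ^ 2 := by
  apply Complex.ofReal_injective
  rw [← qIntegral₂_ofReal, Complex.ofReal_mul, ofReal_normLq_two_sq hq0 hq1,
    ← qIntegral₂_parsevalIntegrand hq0 hK hadm hf hf]
  simp only [ofReal_norm_sq_waveletTransform]

end

end QBessel

open QBessel ComplexConjugate in
theorem mainTheorem2_general {q : ℝ} (hq0 : 0 < q) (hq1 : q < 1) {α : ℝ} {n : ℕ}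
    (hν : -1 < α + n) (hc : qPoch (q ^ (2 * α + 2)) (q ^ 2) n ≠ 0) {Ψ : ℝ → ℂ}
    (hΨ : MemLq q 2 α n Ψ) (hadm : QIntegrable q fun a => ‖fourier q α n Ψ a‖ ^ 2 / a)
    (hΨ0 : ∃ x ∈ lattice q, Ψ x ≠ 0) :
    (0 < admConst q α n Ψ ∧
      (∀ f : ℝ → ℂ, MemLq q 2 α n f → ∀ x ∈ lattice q,
        QIntegrable q (fourierIntegrand q α n f x)) ∧
      (∀ a ∈ lattice q, MemLq q 2 α n (dilate α n Ψ a) ∧ ∀ b ∈ lattice q, ∀ x ∈ lattice q,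
        QIntegrable q (translationIntegrand q α n b (dilate α n Ψ a) x)) ∧
      (∀ f : ℝ → ℂ, MemLq q 2 α n f → ∀ a ∈ lattice q, ∀ b ∈ lattice q,
        QIntegrable q (waveletIntegrand q α n Ψ f a b))) ∧
    (∀ f : ℝ → ℂ, MemLq q 2 α n f →
      QIntegrable₂ q (fun a b => ‖waveletTransform q α n Ψ f a b‖ ^ 2 * weight α n b / a ^ 2) ∧
      1 / admConst q α n Ψ * qIntegral₂ q (fun a b =>
        ‖waveletTransform q α n Ψ f a b‖ ^ 2 * weight α n b / a ^ 2) =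
        normLq q 2 α n f ^ 2) ∧
    (∀ f g : ℝ → ℂ, MemLq q 2 α n f → MemLq q 2 α n g →
      QIntegrable q (fun x => f x * conj (g x) * (weight α n x : ℂ)) ∧
      QIntegrable₂ q (fun a b => waveletTransform q α n Ψ f a b *
        conj (waveletTransform q α n Ψ g a b) * (weight α n b : ℂ) / (a : ℂ) ^ 2) ∧
      qIntegral q (fun x => f x * conj (g x) * (weight α n x : ℂ)) =
        1 / (admConst q α n Ψ : ℂ) * qIntegral₂ q (fun a b => waveletTransform q α n Ψ f a b *
          conj (waveletTransform q α n Ψ g a b) * (weight α n b : ℂ) / (a : ℂ) ^ 2)) := by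
  have hK := isOrthogonalHankel_kernel hq0 hq1 hc hν
  have hP := (admissible_iff hq0 Ψ).1 hadm
  have hC := admConst_pos hq0 hK hq1 hΨ hadm hΨ0
  refine ⟨⟨hC, ?_, ?_, ?_⟩, fun f hf => ⟨?_, ?_⟩, fun f g hf hg => ⟨?_, ?_, ?_⟩⟩
  · rintro f hf _ ⟨k, rfl⟩
    exact qIntegrable_fourierIntegrand hq0 hK hf k
  · rintro _ ⟨i, rfl⟩
    refine ⟨memLq_dilate hq0 hΨ i, ?_⟩
    rintro _ ⟨j, rfl⟩ _ ⟨m, rfl⟩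
    exact qIntegrable_translationIntegrand hq0 hK (memℓp_fourier_dilate hq0 hP i) j m
  · rintro f hf _ ⟨i, rfl⟩ _ ⟨j, rfl⟩
    exact qIntegrable_waveletIntegrand hq0 hK hP hf i j
  · exact qIntegrable₂_norm_sq_waveletTransform hq0 hK hadm hf
  · rw [qIntegral₂_norm_sq_waveletTransform hq0 hK hadm hf hq1, one_div,
      inv_mul_cancel_left₀ hC.ne']
  · exact qIntegrable_mul_conj_mul_weight hq0 hf hg
  · exact qIntegrable₂_parsevalIntegrand hq0 hK hadm hf hg
  · change _ = 1 / (admConst q α n Ψ : ℂ) * qIntegral₂ q (parsevalIntegrand q α n Ψ f g)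
    rw [qIntegral₂_parsevalIntegrand hq0 hK hadm hf hg, one_div,
      inv_mul_cancel_left₀ (Complex.ofReal_ne_zero.2 hC.ne')]

theorem mainTheorem2 (q : ℝ) (hq0 : 0 < q) (hq1 : q < 1) (α : ℝ) (n : ℕ)
    (hv : -1 < QBessel.absV α n) (Ψ : ℝ → ℂ) (hΨ : QBessel.IsWavelet q α n Ψ)
    (hΨ0 : ∃ x ∈ QBessel.lattice q, Ψ x ≠ 0) :
    -- the admissibility constant is positive, and all the integrals converge absolutely
    (0 < QBessel.admConst q α n Ψ ∧
      (∀ f : ℝ → ℂ, QBessel.MemLq q 2 α n f → ∀ x ∈ QBessel.lattice q,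
        QBessel.QIntegrable q (QBessel.fourierIntegrand q α n f x)) ∧
      (∀ a ∈ QBessel.lattice q, QBessel.MemLq q 2 α n (QBessel.dilate α n Ψ a) ∧
        ∀ b ∈ QBessel.lattice q, ∀ x ∈ QBessel.lattice q,
          QBessel.QIntegrable q
            (QBessel.translationIntegrand q α n b (QBessel.dilate α n Ψ a) x)) ∧
      (∀ f : ℝ → ℂ, QBessel.MemLq q 2 α n f →
        ∀ a ∈ QBessel.lattice q, ∀ b ∈ QBessel.lattice q,
          QBessel.QIntegrable q (QBessel.waveletIntegrand q α n Ψ f a b))) ∧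
    -- Plancherel
    (∀ f : ℝ → ℂ, QBessel.MemLq q 2 α n f →
      QBessel.QIntegrable₂ q (fun a b =>
        ‖QBessel.waveletTransform q α n Ψ f a b‖ ^ 2 * QBessel.weight α n b / a ^ 2) ∧
      1 / QBessel.admConst q α n Ψ * QBessel.qIntegral₂ q (fun a b =>
        ‖QBessel.waveletTransform q α n Ψ f a b‖ ^ 2 * QBessel.weight α n b / a ^ 2) =
        QBessel.normLq q 2 α n f ^ 2) ∧
    -- Parseval
    (∀ f g : ℝ → ℂ, QBessel.MemLq q 2 α n f → QBessel.MemLq q 2 α n g →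
      QBessel.QIntegrable q (fun x =>
        f x * (starRingEnd ℂ) (g x) * (QBessel.weight α n x : ℂ)) ∧
      QBessel.QIntegrable₂ q (fun a b =>
        QBessel.waveletTransform q α n Ψ f a b *
          (starRingEnd ℂ) (QBessel.waveletTransform q α n Ψ g a b) *
          (QBessel.weight α n b : ℂ) / (a : ℂ) ^ 2) ∧
      QBessel.qIntegral q (fun x =>
        f x * (starRingEnd ℂ) (g x) * (QBessel.weight α n x : ℂ)) =
        1 / (QBessel.admConst q α n Ψ : ℂ) * QBessel.qIntegral₂ q (fun a b =>
          QBessel.waveletTransform q α n Ψ f a b *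
            (starRingEnd ℂ) (QBessel.waveletTransform q α n Ψ g a b) *
            (QBessel.weight α n b : ℂ) / (a : ℂ) ^ 2)) := by
  have hα : -1 < α := hv.trans_le (QBessel.absV_le α n)
  exact mainTheorem2_general hq0 hq1 (lt_add_of_lt_of_nonneg hα n.cast_nonneg)
    (QBessel.qPoch_rpow_pos hq0 hq1 hα n).ne' hΨ.memLq hΨ.admissible hΨ0
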